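/- **Corollary 1.3.** Let $d\ge 3$ and let $X_0=0,X_1,X_2,\dots$ be a random walk in $\mathbb Z^d$ (independent, identically distributed increments) on a probability space $(\Omega,\mathbf P)$. Assume that the walk is symmetric ($X_1$ and $-X_1$ have the same law), transient (the probability that $X_n=0$ for some $n\ge1$ is less than $1$), not supported on any subgroup strictly smaller than $\mathbb Z^d$, and has finite second moments ($\mathbf E|X_1|^2<\infty$). Here $|\cdot|$ is the Euclidean norm. For $A\subseteq\mathbb Z^d$ let $\mu_n(A)=\sum_{j=0}^n \mathbf 1_A(X_j)$, and let $\gamma_d=\mathbf P(X_n\ne 0\text{ for all }n\ge 1)$ be the probability of no return to the origin. Then for every fixed $K>0$ there is a constant $L$ such that almost surely $$\lim_{n\to\infty}\frac{\max_{x,y\in\mathbb Z^d:\,|x-y|\le K}\mu_n(\{x,y\})}{\log n}=L<-\frac{2}{\log(1-\gamma_d)} .$$ In particular, for every $K>0$ there is $\varepsilon>0$ such that almost surely, for all sufficiently large $n$, any two distinct points $x,y\in\mathbb Z^d$ with $\mu_n(\{x\})\ge(1-\varepsilon)\max_z\mu_n(\{z\})$ and $\mu_n(\{y\})\ge(1-\varepsilon)\max_z\mu_n(\{z\})$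 satisfy $|x-y|>K$. Moreover, almost surely, for all sufficiently large $n$, if $|x-y|=1$ and $\mu_n(\{x\})=\max_z\mu_n(\{z\})$, then $\mu_n(\{y\})<\max_z\mu_n(\{z\})$. -/

import Mathlib

open MeasureTheory ProbabilityTheory Filter Topology

namespace FreqVisited

/-- The lattice `Z^d`. -/
abbrev Lattice (d : ℕ) : Type := Fin d → ℤ

/-- The Euclidean norm of a lattice point. -/
noncomputable def euclNorm {d : ℕ} (x : Lattice d) : ℝ :=
  ‖(WithLp.toLp 2 (fun i => (x i : ℝ)) : EuclideanSpace ℝ (Fin d))‖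

/-- `X` is a random walk in `Z^d`: it starts at the origin and has independent, identically
distributed increments. -/
structure IsRandomWalk {d : ℕ} {Ω : Type*} [MeasurableSpace Ω] (X : ℕ → Ω → Lattice d)
    (P : Measure Ω) : Prop where
  measurable : ∀ n, Measurable (X n)
  start : ∀ᵐ ω ∂P, X 0 ω = 0
  indep : iIndepFun (fun n ω => X (n + 1) ω - X n ω) P
  identDistrib : ∀ n, IdentDistrib (fun ω => X (n + 1) ω - X n ω) (fun ω => X 1 ω - X 0 ω) P P

/-- The step of the walk has the same law as its negative. -/
def IsSymmetric {d : ℕ} {Ω : Type*} [MeasurableSpace Ω] (X : ℕ → Ω → Lattice d)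
    (P : Measure Ω) : Prop :=
  IdentDistrib (X 1) (fun ω => -X 1 ω) P P

/-- The walk returns to the origin with probability less than one. -/
def IsTransient {d : ℕ} {Ω : Type*} [MeasurableSpace Ω] (X : ℕ → Ω → Lattice d)
    (P : Measure Ω) : Prop :=
  P {ω | ∃ n, 1 ≤ n ∧ X n ω = 0} < 1

/-- No subgroup strictly smaller than `Z^d` supports the walk. -/
def IsFullySupported {d : ℕ} {Ω : Type*} [MeasurableSpace Ω] (X : ℕ → Ω → Lattice d)
    (P : Measure Ω) : Prop :=
  ∀ H : AddSubgroup (Lattice d), (∀ᵐ ω ∂P, ∀ n, X n ω ∈ H) → H = ⊤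

/-- The step of the walk has finite second moments. -/
def HasFiniteSecondMoments {d : ℕ} {Ω : Type*} [MeasurableSpace Ω] (X : ℕ → Ω → Lattice d)
    (P : Measure Ω) : Prop :=
  Integrable (fun ω => euclNorm (X 1 ω) ^ 2) P

/-- The probability `γ_d` of no return to the origin. -/
noncomputable def escapeProb {d : ℕ} {Ω : Type*} [MeasurableSpace Ω] (X : ℕ → Ω → Lattice d)
    (P : Measure Ω) : ℝ :=
  P.real {ω | ∀ n, 1 ≤ n → X n ω ≠ 0}

/-- The occupation measure `μ_n(A) = ∑_{j=0}^n 1_A(X_j)`. -/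
noncomputable def occ {d : ℕ} {Ω : Type*} (X : ℕ → Ω → Lattice d) (n : ℕ) (A : Set (Lattice d))
    (ω : Ω) : ℕ :=
  ∑ j ∈ Finset.range (n + 1), A.indicator (fun _ => 1) (X j ω)

/-- The values `μ_n({x,y})` over all pairs `x, y` with `|x - y| ≤ K`. -/
def pairOccValues {d : ℕ} {Ω : Type*} (X : ℕ → Ω → Lattice d) (K : ℝ) (n : ℕ)
    (ω : Ω) : Set ℕ :=
  {m | ∃ x y : Lattice d, euclNorm (x - y) ≤ K ∧ occ X n {x, y} ω = m}

/-- The maximum of `μ_n({x,y})` over all `x, y` with `|x - y| ≤ K`; for `K ≥ 0` it is attained,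
see `isGreatest_maxPairOcc`. -/
noncomputable def maxPairOcc {d : ℕ} {Ω : Type*} (X : ℕ → Ω → Lattice d) (K : ℝ) (n : ℕ)
    (ω : Ω) : ℕ :=
  sSup (pairOccValues X K n ω)

theorem isGreatest_maxPairOcc {d : ℕ} {Ω : Type*} (X : ℕ → Ω → Lattice d) {K : ℝ} (hK : 0 ≤ K)
    (n : ℕ) (ω : Ω) : IsGreatest (pairOccValues X K n ω) (maxPairOcc X K n ω) := by
  classical
  have hb : BddAbove (pairOccValues X K n ω) := by
    refine ⟨n + 1, ?_⟩
    rintro m ⟨x, y, -, rfl⟩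
    calc occ X n {x, y} ω ≤ ∑ _j ∈ Finset.range (n + 1), 1 :=
          Finset.sum_le_sum fun j _ => by
            by_cases h : X j ω ∈ ({x, y} : Set (Lattice d)) <;> simp [Set.indicator, h]
      _ = n + 1 := by simp
  have hne : (pairOccValues X K n ω).Nonempty := by
    refine ⟨_, 0, 0, ?_, rfl⟩
    have h0 : euclNorm ((0 : Lattice d) - 0) = 0 := by
      simp [euclNorm, EuclideanSpace.norm_eq]
    rw [h0]
    exact hK
  exact ⟨Nat.sSup_mem hne hb, fun m hm => le_csSup hb hm⟩

end FreqVisited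

/-! For a pair `{0, z}`, the reflection `x ↦ z - x` preserves the law of a symmetric walk and swaps
the two points. By the Markov property the number of returns to the pair is therefore geometric: `k`
returns have probability `q_z ^ k`, where `q_z` is the probability of returning to the pair. With a
time horizon this becomes the two bounds `tailProb_le_pow` and `pow_le_tailProb`.

Let `q` be the largest `q_z` over the finitely many `|z| ≤ K`. A union bound over the time of the
first visit to the pair, with Borel–Cantelli along powers of two, bounds the maximum by about `log n
/ (-log q)`. Cutting time into independent blocks and applying Borel–Cantelli gives the matching
lower bound, so `L = 1 / (-log q)`.

The strict inequality amounts to `q_z ^ 2 < p`, where `p = 1 - γ_d` (`returnProb_sq_lt`). For `z ≠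
0`, let `a` and `b` be the probabilities that the first return to `{0, z}` is at `0` and at `z`, so
`q_z = a + b`. Conditioning on that return gives `p ≥ a + b ^ 2 / (1 - a)`, which exceeds `(a + b) ^
2`. Hence `L` is less than twice the one-point constant, and two nearly maximal points within
distance `K` would give their pair too many visits. -/

namespace FreqVisited

set_option linter.unusedSectionVars false

/-! ### Return probabilities of a pair, by first-step recursion -/

section Tail

variable {G : Type*} [AddCommGroup G] [MeasurableSpace G]

open Classical in
/-- The probability that a walk with step law `ν` started at `x` visits `A` at least `k` times
during the times `1, …, n`. -/
noncomputable def tailProb (ν : Measure G) (A : Set G) : ℕ → ℕ → G → ENNReal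
  | 0, k, _ => if k = 0 then 1 else 0
  | n + 1, k, x => ∫⁻ y, (if x + y ∈ A then tailProb ν A n (k - 1) (x + y)
      else tailProb ν A n k (x + y)) ∂ν

open Classical in
/-- The probability that a walk with step law `ν` started at `x` visits `A` during the times
`1, …, n` and that its first such visit is in `T`. -/
noncomputable def firstHit (ν : Measure G) (A T : Set G) : ℕ → G → ENNReal
  | 0, _ => 0
  | n + 1, x => ∫⁻ y, (if x + y ∈ A then (if x + y ∈ T then 1 else 0)
      else firstHit ν A T n (x + y)) ∂ν

variable {ν : Measure G} {A T : Set G}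

@[simp] lemma tailProb_zero_right [IsProbabilityMeasure ν] (n : ℕ) (x : G) :
    tailProb ν A n 0 x = 1 := by
  induction n generalizing x with
  | zero => simp [tailProb]
  | succ n ih => simp [tailProb, ih]

lemma tailProb_antitone (n : ℕ) (x : G) : Antitone fun k => tailProb ν A n k x := by
  induction n generalizing x with
  | zero =>
    intro k l h
    by_cases hk : k = 0
    · simp only [tailProb, hk]; split_ifs <;> simp
    · have : l ≠ 0 := by omega
      simp [tailProb, hk, this]
  | succ n ih =>
    intro k l h
    refine lintegral_mono fun y => ?_
    dsimp only
    split_ifs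
    · exact ih _ (by omega)
    · exact ih _ h

lemma tailProb_mono_time (k : ℕ) (x : G) [IsProbabilityMeasure ν] :
    Monotone fun n => tailProb ν A n k x := by
  refine monotone_nat_of_le_succ fun n => ?_
  induction n generalizing k x with
  | zero =>
    by_cases hk : k = 0
    · simp [hk]
    · simp [tailProb, hk]
  | succ n ih =>
    refine lintegral_mono fun y => ?_
    dsimp only
    split_ifs
    · exact ih _ _
    · exact ih _ _

lemma tailProb_le_one [IsProbabilityMeasure ν] (n k : ℕ) (x : G) : tailProb ν A n k x ≤ 1 := by
  simpa using tailProb_antitone (ν := ν) (A := A) n x (Nat.zero_le k)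

lemma firstHit_mono_time (x : G) : Monotone fun n => firstHit ν A T n x := by
  refine monotone_nat_of_le_succ fun n => ?_
  induction n generalizing x with
  | zero => simp [firstHit]
  | succ n ih =>
    refine lintegral_mono fun y => ?_
    dsimp only
    split_ifs
    · exact le_rfl
    · exact le_rfl
    · exact ih _

variable [Countable G] [DiscreteMeasurableSpace G]

lemma lintegral_neg_eq_of_map_neg (hν : ν.map (fun x => -x) = ν) (f : G → ENNReal) :
    ∫⁻ y, f (-y) ∂ν = ∫⁻ y, f y ∂ν := by
  conv_rhs => rw [← hν]
  rw [lintegral_map (by fun_prop) (by fun_prop)]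

lemma sub_mem_pair_iff (z x : G) : z - x ∈ ({0, z} : Set G) ↔ x ∈ ({0, z} : Set G) := by
  simp only [Set.mem_insert_iff, Set.mem_singleton_iff, sub_eq_zero, sub_eq_self]
  tauto

/-- The map `x ↦ z - x` preserves the pair and turns a step `y` into `-y`, which has the same law.
-/
lemma tailProb_reflect (hν : ν.map (fun x => -x) = ν) (z : G) (n k : ℕ) (x : G) :
    tailProb ν {0, z} n k (z - x) = tailProb ν {0, z} n k x := by
  induction n generalizing k x with
  | zero => simp [tailProb]
  | succ n ih =>
    simp only [tailProb]
    rw [← lintegral_neg_eq_of_map_neg hν]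
    refine lintegral_congr fun y => ?_
    have h : z - x + -y = z - (x + y) := by abel
    rw [h, ih, ih]
    by_cases hm : x + y ∈ ({0, z} : Set G)
    · rw [if_pos hm, if_pos ((sub_mem_pair_iff z _).2 hm)]
    · rw [if_neg hm, if_neg (mt (sub_mem_pair_iff z _).1 hm)]

lemma firstHit_reflect (hν : ν.map (fun x => -x) = ν) (z : G) (n : ℕ) (x : G) :
    firstHit ν {0, z} {z} n (z - x) = firstHit ν {0, z} {0} n x := by
  induction n generalizing x with
  | zero => simp [firstHit]
  | succ n ih =>
    simp only [firstHit]
    rw [← lintegral_neg_eq_of_map_neg hν]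
    refine lintegral_congr fun y => ?_
    have h : z - x + -y = z - (x + y) := by abel
    rw [h, ih]
    by_cases hm : x + y ∈ ({0, z} : Set G)
    · rw [if_pos hm, if_pos ((sub_mem_pair_iff z _).2 hm)]
      by_cases h0 : x + y = 0 <;> simp [h0]
    · rw [if_neg hm, if_neg (mt (sub_mem_pair_iff z _).1 hm)]

lemma tailProb_eq_of_mem_pair (hν : ν.map (fun x => -x) = ν) {z w : G}
    (hw : w ∈ ({0, z} : Set G)) (n k : ℕ) :
    tailProb ν {0, z} n k w = tailProb ν {0, z} n k 0 := by
  rcases hw with rfl | rfl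
  · rfl
  · simpa using tailProb_reflect hν w n k 0

/-- Markov property at the first visit to the pair: by reflection it does not matter which point is
hit, and giving the remaining `k` visits the full time `n` only helps. -/
lemma tailProb_succ_le [IsProbabilityMeasure ν] (hν : ν.map (fun x => -x) = ν) (z : G)
    (n k : ℕ) (x : G) :
    tailProb ν {0, z} n (k + 1) x ≤ tailProb ν {0, z} n k 0 * tailProb ν {0, z} n 1 x := by
  -- The two horizons are decoupled because the induction shortens only that of the first visit.
  suffices h : ∀ m, n ≤ m → tailProb ν {0, z} n (k + 1) x ≤
      tailProb ν {0, z} m k 0 * tailProb ν {0, z} n 1 x from h n le_rfl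
  induction n generalizing x with
  | zero => simp [tailProb]
  | succ n ih =>
    intro m hm
    simp only [tailProb]
    rw [← lintegral_const_mul _ (by fun_prop)]
    refine lintegral_mono fun y => ?_
    dsimp only
    split_ifs with h
    · simp only [Nat.add_sub_cancel, Nat.sub_self, tailProb_zero_right, mul_one]
      rw [tailProb_eq_of_mem_pair hν h]
      exact tailProb_mono_time k 0 (by omega)
    · exact ih _ _ (by omega)

/-- If the first visit occurs within `m` steps, at least `n` of the `n + m` steps are left for the
other `k`. -/
lemma le_tailProb_succ [IsProbabilityMeasure ν] (hν : ν.map (fun x => -x) = ν) (z : G)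
    (n m k : ℕ) (x : G) :
    tailProb ν {0, z} n k 0 * tailProb ν {0, z} m 1 x ≤ tailProb ν {0, z} (n + m) (k + 1) x := by
  induction m generalizing x with
  | zero => simp [tailProb]
  | succ m ih =>
    rw [← add_assoc]
    simp only [tailProb]
    rw [← lintegral_const_mul _ (by fun_prop)]
    refine lintegral_mono fun y => ?_
    dsimp only
    split_ifs with h
    · simp only [Nat.add_sub_cancel, Nat.sub_self, tailProb_zero_right, mul_one]
      rw [tailProb_eq_of_mem_pair hν h]
      exact tailProb_mono_time k 0 (by omega)
    · exact ih _

lemma tailProb_le_pow [IsProbabilityMeasure ν] (hν : ν.map (fun x => -x) = ν) (z : G)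
    (n k : ℕ) : tailProb ν {0, z} n k 0 ≤ tailProb ν {0, z} n 1 0 ^ k := by
  induction k with
  | zero => simp
  | succ k ih =>
    rw [pow_succ]
    exact (tailProb_succ_le hν z n k 0).trans (by gcongr)

lemma pow_le_tailProb [IsProbabilityMeasure ν] (hν : ν.map (fun x => -x) = ν) (z : G)
    (m k : ℕ) : tailProb ν {0, z} m 1 0 ^ k ≤ tailProb ν {0, z} (m * k) k 0 := by
  induction k with
  | zero => simp
  | succ k ih =>
    rw [pow_succ, mul_add, mul_one]
    exact le_trans (by gcongr) (le_tailProb_succ hν z (m * k) m k 0)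

lemma tailProb_one_eq_add [IsProbabilityMeasure ν] {z : G} (hz : z ≠ 0) (n : ℕ) (x : G) :
    tailProb ν {0, z} n 1 x = firstHit ν {0, z} {0} n x + firstHit ν {0, z} {z} n x := by
  induction n generalizing x with
  | zero => simp [tailProb, firstHit]
  | succ n ih =>
    simp only [tailProb, firstHit]
    rw [← lintegral_add_left (by fun_prop)]
    refine lintegral_congr fun y => ?_
    by_cases h : x + y ∈ ({0, z} : Set G)
    · rw [if_pos h, if_pos h, if_pos h]
      simp only [Nat.sub_self, tailProb_zero_right, Set.mem_singleton_iff]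
      rcases h with h | h
      · simp [h, hz.symm]
      · rw [Set.mem_singleton_iff] at h
        simp [h, hz]
    · rw [if_neg h, if_neg h, if_neg h, ih]

/-- One way to reach `0` is to hit the pair first at `0`; a disjoint way is to hit it first at `z`
and then go from `z` to `0`. -/
lemma firstHit_add_mul_le [IsProbabilityMeasure ν] {z : G} (hz : z ≠ 0) (m n : ℕ) (x : G) :
    firstHit ν {0, z} {0} n x + firstHit ν {0, z} {z} n x * tailProb ν {0} m 1 z
      ≤ tailProb ν {0} (m + n) 1 x := by
  induction n generalizing x with
  | zero => simp [firstHit]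
  | succ n ih =>
    rw [← add_assoc]
    simp only [tailProb, firstHit]
    rw [← lintegral_mul_const _ (by fun_prop), ← lintegral_add_left (by fun_prop)]
    refine lintegral_mono fun y => ?_
    dsimp only
    by_cases h0 : x + y = 0
    · simp [h0, hz.symm]
    by_cases h1 : x + y = z
    · simp only [h1, Set.mem_insert_iff, Set.mem_singleton_iff, hz, or_true, if_true, if_false,
        zero_add, one_mul]
      exact tailProb_mono_time 1 z (by omega)
    · simpa [h0, h1] using ih (x + y)

/-- The probability that a walk with step law `ν` started at `0` returns to `{0, z}`. -/
noncomputable def returnProb (ν : Measure G) (z : G) : ENNReal := ⨆ n, tailProb ν {0, z} n 1 0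

lemma tailProb_le_returnProb (z : G) (n : ℕ) :
    tailProb ν {0, z} n 1 0 ≤ returnProb ν z := le_iSup (fun n => tailProb ν {0, z} n 1 0) n

lemma returnProb_le_one [IsProbabilityMeasure ν] (z : G) : returnProb ν z ≤ 1 :=
  iSup_le fun n => tailProb_le_one n 1 0

lemma exists_measure_singleton_ne_zero [IsProbabilityMeasure ν] : ∃ e, ν {e} ≠ 0 := by
  by_contra! h
  have : ν Set.univ = 0 := by
    rw [← Set.biUnion_of_singleton Set.univ]
    exact (measure_biUnion_null_iff Set.countable_univ).2 fun i _ => h i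
  simp at this

lemma measure_singleton_neg (hν : ν.map (fun x => -x) = ν) (e : G) : ν {-e} = ν {e} := by
  conv_lhs => rw [← hν, Measure.map_apply (by fun_prop) (.of_discrete)]
  simp

lemma le_lintegral_of_singleton (f : G → ENNReal) (e : G) : f e * ν {e} ≤ ∫⁻ y, f y ∂ν := by
  calc f e * ν {e} = ∫⁻ y in {e}, f y ∂ν := by rw [lintegral_singleton]
    _ ≤ _ := setLIntegral_le_lintegral _ _

/-- A possible step `e` followed by `-e` returns to `0`. If `e = z`, its negative is used instead,
so that the path avoids `z`; if `e = 0`, the return already occurs at time one. -/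
lemma firstHit_two_pos [IsProbabilityMeasure ν] (hν : ν.map (fun x => -x) = ν) {z : G}
    (hz : z ≠ -z) : firstHit ν {0, z} {0} 2 0 ≠ 0 := by
  obtain ⟨e, he, hez⟩ : ∃ e, ν {e} ≠ 0 ∧ e ≠ z := by
    obtain ⟨e, he⟩ := exists_measure_singleton_ne_zero (ν := ν)
    by_cases h : e = z
    · exact ⟨-e, by rwa [measure_singleton_neg hν], by rw [h]; exact hz.symm⟩
    · exact ⟨e, he, h⟩
  have he' : ν {-e} ≠ 0 := by rwa [measure_singleton_neg hν]
  rw [← pos_iff_ne_zero]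
  unfold firstHit
  refine lt_of_lt_of_le ?_ (le_lintegral_of_singleton _ e)
  refine ENNReal.mul_pos ?_ he
  by_cases h0 : e = 0
  · simp [h0]
  · simp only [zero_add, Set.mem_insert_iff, h0, hez, Set.mem_singleton_iff, or_self, if_false]
    rw [← pos_iff_ne_zero]
    unfold firstHit
    refine lt_of_lt_of_le ?_ (le_lintegral_of_singleton _ (-e))
    exact ENNReal.mul_pos (by simp) he'

lemma iSup_add_iSup_mul_le {z : G} {a b : ℕ → ENNReal} {c : ENNReal} (ha : Monotone a)
    (hb : Monotone b)
    (h : ∀ n m, a n + b n * tailProb ν {0} m 1 z ≤ c) :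
    (⨆ n, a n) + (⨆ n, b n) * (⨆ m, tailProb ν {0} m 1 z) ≤ c := by
  rw [ENNReal.iSup_mul, ENNReal.iSup_add_iSup_of_monotone ha]
  · refine iSup_le fun n => ?_
    rw [ENNReal.mul_iSup, ENNReal.add_iSup]
    exact iSup_le fun m => h n m
  · exact fun i j hij => mul_le_mul_left (hb hij) _

/-- Eliminating `h` gives `a + b ^ 2 / (1 - a) ≤ p`. Since `p < 1`, this forces `b < 1 - a`. -/
lemma sq_lt_of_first_step {a b h p : ℝ} (ha : 0 < a) (hb : 0 ≤ b) (hp : p < 1)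
    (h1 : a + b * h ≤ p) (h2 : b + a * h ≤ h) (hh : 0 ≤ h) : a + b < 1 ∧ (a + b) ^ 2 < p := by
  have ha1 : a < 1 := by nlinarith [mul_nonneg hb hh]
  have h3 : b / (1 - a) ≤ h := by rw [div_le_iff₀ (by linarith)]; nlinarith
  have h4 : a + b ^ 2 / (1 - a) ≤ p := by
    have : b * (b / (1 - a)) ≤ b * h := by gcongr
    have e : b * (b / (1 - a)) = b ^ 2 / (1 - a) := by ring
    linarith
  have hb1 : a + b < 1 := by
    have : b ^ 2 / (1 - a) < 1 - a := by linarith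
    rw [div_lt_iff₀ (by linarith)] at this
    nlinarith
  refine ⟨hb1, lt_of_lt_of_le ?_ h4⟩
  rw [← sub_lt_iff_lt_add', lt_div_iff₀ (by linarith)]
  -- The identity behind this is `(1 - a) * (a - (a + b) ^ 2) + b ^ 2 = a * (1 - a - b) ^ 2`.
  nlinarith [mul_pos ha (pow_pos (sub_pos.2 hb1) 2)]

/-- Returning to a pair of points is less likely than the square root of the probability of
returning to a single point. -/
lemma returnProb_sq_lt [IsProbabilityMeasure ν] (hν : ν.map (fun x => -x) = ν) {z : G}
    (hz : z ≠ -z) (hp : returnProb ν 0 < 1) :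
    0 < (returnProb ν 0).toReal ∧ (returnProb ν z).toReal < 1 ∧
      (returnProb ν z).toReal ^ 2 < (returnProb ν 0).toReal := by
  have hz0 : z ≠ 0 := by rintro rfl; simp at hz
  set a := ⨆ n, firstHit ν {0, z} {0} n 0 with ha
  set b := ⨆ n, firstHit ν {0, z} {z} n 0 with hb
  set h := ⨆ n, tailProb ν {0} n 1 z with hh
  have hq : returnProb ν z = a + b := by
    rw [returnProb, ha, hb, ENNReal.iSup_add_iSup_of_monotone (firstHit_mono_time 0)
      (firstHit_mono_time 0)]
    simp only [tailProb_one_eq_add hz0]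
  have hpe : returnProb ν 0 = ⨆ n, tailProb ν {0} n 1 0 := by simp [returnProb]
  have h1 : a + b * h ≤ returnProb ν 0 := by
    refine iSup_add_iSup_mul_le (firstHit_mono_time 0) (firstHit_mono_time 0) fun n m => ?_
    rw [hpe]
    exact (firstHit_add_mul_le hz0 m n 0).trans (le_iSup (fun n => tailProb ν {0} n 1 0) (m + n))
  -- Seen from `z`, reflection swaps the roles: the pair is first hit at `0` with probability `b`
  -- and at `z` with probability `a`.
  have h2 : b + a * h ≤ h := by
    refine iSup_add_iSup_mul_le (firstHit_mono_time 0) (firstHit_mono_time 0) fun n m => ?_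
    have e1 := firstHit_reflect hν z n z
    have e2 := firstHit_reflect hν z n 0
    rw [sub_self] at e1
    rw [sub_zero] at e2
    rw [e1, ← e2]
    exact (firstHit_add_mul_le hz0 m n z).trans (le_iSup (fun n => tailProb ν {0} n 1 z) (m + n))
  have hq1 := returnProb_le_one (ν := ν) z
  have hh1 : h ≤ 1 := iSup_le fun n => tailProb_le_one n 1 z
  have hat : a ≠ ⊤ := ne_top_of_le_ne_top ENNReal.one_ne_top ((le_self_add.trans hq.ge).trans hq1)
  have hbt : b ≠ ⊤ := ne_top_of_le_ne_top ENNReal.one_ne_top ((le_add_self.trans hq.ge).trans hq1)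
  have hht : h ≠ ⊤ := ne_top_of_le_ne_top ENNReal.one_ne_top hh1
  have ha0 : 0 < a.toReal := by
    refine ENNReal.toReal_pos (fun h0 => ?_) hat
    rw [ha, ENNReal.iSup_eq_zero] at h0
    exact firstHit_two_pos hν hz (h0 2)
  have r1 : a.toReal + b.toReal * h.toReal ≤ (returnProb ν 0).toReal := by
    rw [← ENNReal.toReal_mul, ← ENNReal.toReal_add hat (ENNReal.mul_ne_top hbt hht)]
    exact ENNReal.toReal_mono hp.ne_top h1
  have r2 : b.toReal + a.toReal * h.toReal ≤ h.toReal := by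
    rw [← ENNReal.toReal_mul, ← ENNReal.toReal_add hbt (ENNReal.mul_ne_top hat hht)]
    exact ENNReal.toReal_mono hht h2
  have r3 : (returnProb ν 0).toReal < 1 := by
    rw [← ENNReal.toReal_one]
    exact (ENNReal.toReal_lt_toReal hp.ne_top ENNReal.one_ne_top).2 hp
  have hb0 : 0 ≤ b.toReal := ENNReal.toReal_nonneg
  have hh0 : 0 ≤ h.toReal := ENNReal.toReal_nonneg
  have := sq_lt_of_first_step ha0 hb0 r3 r1 r2 hh0
  rw [hq, ENNReal.toReal_add hat hbt]
  exact ⟨by nlinarith, this⟩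

end Tail

/-! ### Path space of i.i.d. steps -/

section Visits

variable {G : Type*} [AddCommGroup G]

/-- The number of visits to `A` during the times `1, …, n` of the walk with steps `ω`
started at `x`. -/
noncomputable def visits (A : Set G) (x : G) (ω : ℕ → G) (n : ℕ) : ℕ :=
  ∑ i ∈ Finset.range n, A.indicator (fun _ => 1) (x + ∑ j ∈ Finset.range (i + 1), ω j)

lemma visits_succ (A : Set G) (x : G) (ω : ℕ → G) (n : ℕ) :
    visits A x ω (n + 1) = A.indicator (fun _ => 1) (x + ω 0) +
      visits A (x + ω 0) (fun i => ω (i + 1)) n := by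
  rw [visits, Finset.sum_range_succ', add_comm, visits]
  simp only [zero_add, Finset.sum_range_one]
  congr 1
  refine Finset.sum_congr rfl fun i _ => ?_
  rw [Finset.sum_range_succ' _ (i + 1)]
  congr 1
  abel

lemma visits_mono (A : Set G) (x : G) (ω : ℕ → G) : Monotone (visits A x ω) := fun _ _ h =>
  Finset.sum_le_sum_of_subset (Finset.range_mono h)

lemma visits_congr (A : Set G) (x : G) {ω ω' : ℕ → G} {n : ℕ} (h : ∀ i < n, ω i = ω' i) :
    visits A x ω n = visits A x ω' n := by
  refine Finset.sum_congr rfl fun i hi => ?_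
  congr 2
  refine Finset.sum_congr rfl fun j hj => h j ?_
  simp only [Finset.mem_range] at hi hj
  omega

variable [MeasurableSpace G] [Countable G] [DiscreteMeasurableSpace G]

lemma measurable_visits (A : Set G) (x : G) (n : ℕ) :
    Measurable fun ω : ℕ → G => visits A x ω n := by
  refine Finset.measurable_sum _ fun i _ => ?_
  exact (Measurable.of_discrete (f := fun y : G => A.indicator (fun _ => (1 : ℕ)) (x + y))).comp
    (Finset.measurable_sum _ fun j _ => measurable_pi_apply j)

/-- The sequence that starts with the first `r` terms of `p.1` and continues with `p.2`. -/
def splice (r : ℕ) (p : (ℕ → G) × (ℕ → G)) : ℕ → G :=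
  fun j => if j < r then p.1 j else p.2 (j - r)

lemma measurable_splice (r : ℕ) : Measurable (splice (G := G) r) := by
  refine measurable_pi_iff.2 fun j => ?_
  unfold splice
  split_ifs
  · exact (measurable_pi_apply j).comp measurable_fst
  · exact (measurable_pi_apply _).comp measurable_snd

variable {ν : Measure G} [IsProbabilityMeasure ν]

/-- This is the Markov property at the fixed time `r`. On a cylinder, the coordinates below `r`
constrain the first sequence, and the others, shifted back by `r`, the second. -/
lemma map_splice (r : ℕ) :
    ((Measure.infinitePi fun _ : ℕ => ν).prod (Measure.infinitePi fun _ : ℕ => ν)).map (splice r)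
      = Measure.infinitePi fun _ : ℕ => ν := by
  refine Measure.eq_infinitePi _ fun s t ht => ?_
  rw [Measure.map_apply (measurable_splice r) (.pi s.countable_toSet fun i _ => ht i)]
  have : splice (G := G) r ⁻¹' (s : Set ℕ).pi t =
      Set.pi ((s.filter (· < r) : Finset ℕ) : Set ℕ) t ×ˢ
      Set.pi (((s.filter (¬ · < r)).image (· - r) : Finset ℕ) : Set ℕ) (fun j => t (j + r)) := by
    ext p
    simp only [Set.mem_preimage, Set.mem_pi, Set.mem_prod, Finset.mem_coe, Finset.mem_filter,
      Finset.mem_image, splice]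
    constructor
    · intro h
      refine ⟨fun i hi => by simpa [hi.2] using h i hi.1, ?_⟩
      rintro _ ⟨i, hi, rfl⟩
      have := h i hi.1
      rw [if_neg hi.2] at this
      rwa [Nat.sub_add_cancel (by omega)]
    · intro h i hi
      split_ifs with hr
      · exact h.1 i ⟨hi, hr⟩
      · have := h.2 _ ⟨i, ⟨hi, hr⟩, rfl⟩
        rwa [Nat.sub_add_cancel (by omega)] at this
  rw [this, Measure.prod_prod, Measure.infinitePi_pi _ fun i _ => ht i,
    Measure.infinitePi_pi _ fun i _ => ht _, Finset.prod_image,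
    ← Finset.prod_filter_mul_prod_filter_not s (· < r)]
  · congr 1
    refine Finset.prod_congr rfl fun i hi => ?_
    simp only [Finset.mem_filter] at hi
    rw [Nat.sub_add_cancel (by omega)]
  · intro i hi j hj hij
    simp only [Finset.coe_filter, Set.mem_ofPred_eq] at hi hj
    dsimp only at hij
    omega

lemma measurableSet_le_visits (A : Set G) (x : G) (n k : ℕ) :
    MeasurableSet {ω : ℕ → G | k ≤ visits A x ω n} :=
  measurableSet_le measurable_const (measurable_visits A x n)

lemma lintegral_infinitePi_head (f : G → ENNReal) :
    ∫⁻ α, f (α 0) ∂(Measure.infinitePi fun _ : ℕ => ν) = ∫⁻ y, f y ∂ν := by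
  conv_rhs => rw [← Measure.infinitePi_map_eval (fun _ : ℕ => ν) 0]
  rw [lintegral_map .of_discrete (measurable_pi_apply 0)]

/-- Splicing off one step reproduces the recursion of `tailProb`; its truncated `k - 1` matches
subtracting the indicator of the first visit. -/
lemma infinitePi_le_visits (A : Set G) (x : G) (n k : ℕ) :
    (Measure.infinitePi fun _ : ℕ => ν) {ω | k ≤ visits A x ω n} = tailProb ν A n k x := by
  classical
  induction n generalizing k x with
  | zero =>
    by_cases hk : k = 0
    · simp [hk]
    · simp [visits, tailProb, hk]
  | succ n ih =>
    rw [← map_splice 1, Measure.map_apply (measurable_splice 1) (measurableSet_le_visits A x _ k),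
      Measure.prod_apply ((measurableSet_le_visits A x _ k).preimage (measurable_splice 1)),
      tailProb]
    refine Eq.trans (lintegral_congr fun α => ?_) (lintegral_infinitePi_head _)
    have h : Prod.mk α ⁻¹' (splice 1 ⁻¹' {ω | k ≤ visits A x ω (n + 1)}) =
        {ω | k - A.indicator (fun _ => 1) (x + α 0) ≤ visits A (x + α 0) ω n} := by
      ext ω
      have e : (fun i => splice 1 (α, ω) (i + 1)) = ω := by
        funext i
        simp [splice]
      simp only [Set.mem_preimage, Set.mem_ofPred_eq, visits_succ, e]
      simp only [splice, zero_lt_one, if_true]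
      omega
    rw [h, ih]
    by_cases hA : x + α 0 ∈ A <;> simp [hA]

lemma measurableSet_blocks (A : Set G) (r k N : ℕ) :
    MeasurableSet {ω : ℕ → G | ∀ i < N, visits A 0 (fun j => ω (i * r + j)) r < k} := by
  simp only [Set.ofPred_forall]
  refine .iInter fun i => .iInter fun _ => ?_
  exact measurableSet_lt ((measurable_visits A 0 r).comp
    (measurable_pi_iff.2 fun j => measurable_pi_apply _)) measurable_const

/-- Disjoint blocks of steps are independent. -/
lemma infinitePi_blocks (A : Set G) (r k N : ℕ) :
    (Measure.infinitePi fun _ : ℕ => ν)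
      {ω | ∀ i < N, visits A 0 (fun j => ω (i * r + j)) r < k} =
      (1 - tailProb ν A r k 0) ^ N := by
  induction N with
  | zero => simp
  | succ N ih =>
    conv_lhs => rw [← map_splice r, Measure.map_apply (measurable_splice r)
      (measurableSet_blocks A r k _)]
    have h : splice r ⁻¹' {ω : ℕ → G | ∀ i < N + 1, visits A 0 (fun j => ω (i * r + j)) r < k} =
        {ω | k ≤ visits A 0 ω r}ᶜ ×ˢ
          {ω | ∀ i < N, visits A 0 (fun j => ω (i * r + j)) r < k} := by
      ext ⟨α, ω⟩
      simp only [Set.mem_preimage, Set.mem_ofPred_eq, Set.mem_prod, Set.mem_compl_iff, not_le]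
      have h0 : visits A 0 (fun j => splice r (α, ω) (0 * r + j)) r = visits A 0 α r :=
        visits_congr A 0 fun i hi => by simp [splice, hi]
      have h1 : ∀ i, (fun j => splice r (α, ω) ((i + 1) * r + j)) = fun j => ω (i * r + j) := by
        intro i
        funext j
        have : (i + 1) * r + j = i * r + j + r := by ring
        simp [splice, this]
      constructor
      · intro h
        refine ⟨h0 ▸ h 0 (by omega), fun i hi => ?_⟩
        have := h (i + 1) (by omega)
        rwa [h1] at this
      · rintro ⟨h2, h3⟩ (_ | i) hi
        · rwa [h0]
        · rw [h1]
          exact h3 i (by omega)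
    rw [h, Measure.prod_prod, ih, prob_compl_eq_one_sub (measurableSet_le_visits A 0 r k),
      infinitePi_le_visits, pow_succ']

end Visits

/-! ### Occupation counts in terms of returns -/

section Occupation

variable {d : ℕ} {Ω : Type*} (X : ℕ → Ω → Lattice d)

/-- The steps of the walk from time `s` on. -/
def steps (s : ℕ) (ω : Ω) : ℕ → Lattice d := fun i => X (s + i + 1) ω - X (s + i) ω

lemma add_sum_steps (s i : ℕ) (ω : Ω) :
    X s ω + ∑ j ∈ Finset.range i, steps X s ω j = X (s + i) ω := by
  have := Finset.sum_range_sub (fun j => X (s + j) ω) i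
  simp only [steps, add_assoc] at this ⊢
  rw [this]
  simp

lemma indicator_add_pair (x z w : Lattice d) :
    ({x, x + z} : Set (Lattice d)).indicator (fun _ => (1 : ℕ)) (x + w) =
      ({0, z} : Set (Lattice d)).indicator (fun _ => 1) w := by
  classical
  simp [Set.indicator_apply]

lemma occ_pair_eq (s n : ℕ) (z : Lattice d) (ω : Ω) :
    occ X (s + n) {X s ω, X s ω + z} ω =
      (∑ j ∈ Finset.range s, ({X s ω, X s ω + z} : Set (Lattice d)).indicator (fun _ => 1) (X j ω))
        + 1 + visits {0, z} 0 (steps X s ω) n := by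
  rw [occ, add_assoc s, Finset.sum_range_add, add_assoc]
  congr 1
  rw [Finset.sum_range_succ', add_comm]
  congr 1
  · simp
  · refine Finset.sum_congr rfl fun i _ => ?_
    rw [← add_sum_steps X s (i + 1), indicator_add_pair, zero_add]

lemma le_occ_pair {s r n k : ℕ} {z : Lattice d} {ω : Ω} (h : s + r ≤ n)
    (hk : k ≤ visits {0, z} 0 (steps X s ω) r) : k ≤ occ X n {X s ω, X s ω + z} ω := by
  obtain ⟨t, rfl⟩ := Nat.exists_eq_add_of_le h
  rw [add_assoc, occ_pair_eq]
  have := visits_mono ({0, z} : Set (Lattice d)) 0 (steps X s ω) (Nat.le_add_right r t)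
  omega

/-- Take `s` to be the first visit to the pair. It accounts for one unit, hence the strict
inequality, and all other visits are returns of the walk restarted at `s`. -/
lemma exists_le_visits_of_lt_occ {n k : ℕ} {x y : Lattice d} {ω : Ω}
    (h : k < occ X n {x, y} ω) :
    ∃ s ≤ n, ∃ z, (z = x - y ∨ z = y - x) ∧ k ≤ visits {0, z} 0 (steps X s ω) n := by
  classical
  have hex : ∃ s, s ≤ n ∧ X s ω ∈ ({x, y} : Set (Lattice d)) := by
    by_contra! hc
    have : occ X n {x, y} ω = 0 := Finset.sum_eq_zero fun j hj =>
      Set.indicator_of_notMem (hc j (by simpa [Nat.lt_succ_iff] using hj)) _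
    omega
  set s := Nat.find hex with hs
  obtain ⟨hsn, hmem⟩ := Nat.find_spec hex
  rw [← hs] at hsn hmem
  obtain ⟨z, hz, hset⟩ : ∃ z, (z = x - y ∨ z = y - x) ∧
      ({x, y} : Set (Lattice d)) = {X s ω, X s ω + z} := by
    rcases hmem with h1 | h1
    · exact ⟨y - x, .inr rfl, by rw [h1]; simp⟩
    · rw [Set.mem_singleton_iff] at h1
      exact ⟨x - y, .inl rfl, by rw [h1]; simp [Set.pair_comm]⟩
  refine ⟨s, hsn, z, hz, ?_⟩
  obtain ⟨t, ht⟩ := Nat.exists_eq_add_of_le hsn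
  have h0 : ∑ j ∈ Finset.range s,
      ({x, y} : Set (Lattice d)).indicator (fun _ => (1 : ℕ)) (X j ω) = 0 := by
    refine Finset.sum_eq_zero fun j hj => Set.indicator_of_notMem (fun hm => ?_) _
    rw [Finset.mem_range] at hj
    exact Nat.find_min hex hj ⟨by omega, hm⟩
  rw [hset] at h h0
  rw [ht, occ_pair_eq, h0] at h
  have := visits_mono ({0, z} : Set (Lattice d)) 0 (steps X s ω) (show t ≤ n by omega)
  omega

lemma occ_mono_time (A : Set (Lattice d)) (ω : Ω) : Monotone fun n => occ X n A ω := fun _ _ h =>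
  Finset.sum_le_sum_of_subset (Finset.range_mono (by omega))

lemma occ_pair_of_ne {x y : Lattice d} (h : x ≠ y) (n : ℕ) (ω : Ω) :
    occ X n {x, y} ω = occ X n {x} ω + occ X n {y} ω := by
  classical
  rw [occ, occ, occ, ← Finset.sum_add_distrib]
  refine Finset.sum_congr rfl fun j _ => ?_
  by_cases h1 : X j ω = x
  · simp [h1, h]
  · simp [Set.indicator_apply, h1]

lemma euclNorm_neg (x : Lattice d) : euclNorm (-x) = euclNorm x := by
  simp [euclNorm, EuclideanSpace.norm_eq]

lemma euclNorm_sub_rev (x y : Lattice d) : euclNorm (x - y) = euclNorm (y - x) := by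
  rw [← euclNorm_neg, neg_sub]

lemma abs_le_euclNorm (x : Lattice d) (i : Fin d) : |(x i : ℝ)| ≤ euclNorm x := by
  simpa [euclNorm] using
    PiLp.norm_apply_le (WithLp.toLp 2 (fun i => (x i : ℝ)) : EuclideanSpace ℝ (Fin d)) i

lemma finite_euclNorm_le (K : ℝ) : {z : Lattice d | euclNorm z ≤ K}.Finite := by
  refine (Set.Finite.pi' (t := fun _ : Fin d => Set.Icc (-⌈K⌉) ⌈K⌉) fun _ =>
    Set.finite_Icc _ _).subset fun z hz i => ?_
  have h := abs_le.1 ((abs_le_euclNorm z i).trans (le_trans hz (Int.le_ceil K)))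
  constructor
  · exact_mod_cast h.1
  · exact_mod_cast h.2

lemma euclNorm_zero : euclNorm (0 : Lattice d) = 0 := by
  simp [euclNorm, EuclideanSpace.norm_eq]

lemma occ_le_maxPairOcc {K : ℝ} (hK : 0 ≤ K) {x y : Lattice d} (h : euclNorm (x - y) ≤ K)
    (n : ℕ) (ω : Ω) : occ X n {x, y} ω ≤ maxPairOcc X K n ω :=
  (isGreatest_maxPairOcc X hK n ω).2 ⟨x, y, h, rfl⟩

lemma maxPairOcc_mono_time {K : ℝ} (hK : 0 ≤ K) (ω : Ω) :
    Monotone fun n => maxPairOcc X K n ω := by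
  intro m n hmn
  obtain ⟨x, y, hxy, h⟩ := (isGreatest_maxPairOcc X hK m ω).1
  dsimp only
  rw [← h]
  exact (occ_mono_time X _ ω hmn).trans (occ_le_maxPairOcc X hK hxy n ω)

lemma exists_le_visits_of_lt_maxPairOcc {K : ℝ} (hK : 0 ≤ K) {n k : ℕ} {ω : Ω}
    (h : k < maxPairOcc X K n ω) :
    ∃ s ≤ n, ∃ z, euclNorm z ≤ K ∧ k ≤ visits {0, z} 0 (steps X s ω) n := by
  obtain ⟨x, y, hxy, h'⟩ := (isGreatest_maxPairOcc X hK n ω).1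
  rw [← h'] at h
  obtain ⟨s, hs, z, hz, hk⟩ := exists_le_visits_of_lt_occ X h
  refine ⟨s, hs, z, ?_, hk⟩
  rcases hz with rfl | rfl
  · exact hxy
  · rwa [euclNorm_sub_rev]

end Occupation

/-! ### Tail bounds for the random walk -/

section Walk

variable {d : ℕ} {Ω : Type*} [MeasurableSpace Ω] {P : Measure Ω} [IsProbabilityMeasure P]
  {X : ℕ → Ω → Lattice d}

lemma IsRandomWalk.measurable_steps (hX : IsRandomWalk X P) (s : ℕ) : Measurable (steps X s) :=
  measurable_pi_iff.2 fun i => (hX.measurable (s + i + 1)).sub (hX.measurable (s + i))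

lemma IsRandomWalk.isProbabilityMeasure_law (hX : IsRandomWalk X P) :
    IsProbabilityMeasure (P.map (X 1)) :=
  Measure.isProbabilityMeasure_map (hX.measurable 1).aemeasurable

lemma IsRandomWalk.map_steps (hX : IsRandomWalk X P) (s : ℕ) :
    P.map (steps X s) = Measure.infinitePi fun _ : ℕ => P.map (X 1) := by
  have h := hX.indep.precomp (g := fun i => s + i) (add_right_injective s)
  have h2 := iIndepFun.map_fun_eq_infinitePi_map
    (fun i => (hX.measurable (s + i + 1)).sub (hX.measurable (s + i))) h
  refine h2.trans ?_
  congr 1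
  funext i
  refine (hX.identDistrib (s + i)).map_eq.trans (Measure.map_congr ?_)
  filter_upwards [hX.start] with ω hω
  simp [hω]

lemma IsRandomWalk.measure_steps (hX : IsRandomWalk X P) (s : ℕ) {E : Set (ℕ → Lattice d)}
    (hE : MeasurableSet E) :
    P {ω | steps X s ω ∈ E} = (Measure.infinitePi fun _ : ℕ => P.map (X 1)) E := by
  rw [← hX.map_steps s, Measure.map_apply (hX.measurable_steps s) hE]
  rfl

lemma IsRandomWalk.map_neg_law (hX : IsRandomWalk X P) (hs : IsSymmetric X P) :
    (P.map (X 1)).map (fun x => -x) = P.map (X 1) := by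
  rw [Measure.map_map .of_discrete (hX.measurable 1)]
  exact hs.map_eq.symm

lemma IsRandomWalk.returnProb_zero (hX : IsRandomWalk X P) :
    returnProb (P.map (X 1)) 0 = P {ω | ∃ n, 1 ≤ n ∧ X n ω = 0} := by
  have := hX.isProbabilityMeasure_law
  have h1 : P {ω | ∃ n, 1 ≤ n ∧ X n ω = 0} =
      P (⋃ n, {ω | steps X 0 ω ∈ {v | 1 ≤ visits {0, 0} 0 v n}}) := by
    refine measure_congr ?_
    filter_upwards [hX.start] with ω hω
    have hv : ∀ n, X n ω = ∑ j ∈ Finset.range n, steps X 0 ω j := fun n => by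
      have := add_sum_steps X 0 n ω
      rwa [hω, zero_add, zero_add, eq_comm] at this
    refine propext ?_
    change (∃ n, 1 ≤ n ∧ X n ω = 0) ↔ ω ∈ ⋃ n, {ω | 1 ≤ visits {0, 0} 0 (steps X 0 ω) n}
    simp only [Set.mem_iUnion, Set.mem_ofPred_eq, visits, zero_add, ← hv]
    constructor
    · rintro ⟨n, hn, h⟩
      refine ⟨n, ?_⟩
      refine le_trans ?_ (Finset.single_le_sum (fun _ _ => Nat.zero_le _)
        (Finset.mem_range.2 (show n - 1 < n by omega)))
      simp [Nat.sub_add_cancel hn, h]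
    · rintro ⟨n, h⟩
      obtain ⟨i, -, hi⟩ := Finset.exists_ne_zero_of_sum_ne_zero (Nat.one_le_iff_ne_zero.1 h)
      exact ⟨i + 1, by omega, by simpa using Set.mem_of_indicator_ne_zero hi⟩
  rw [h1, Monotone.measure_iUnion]
  · refine iSup_congr fun n => ?_
    rw [hX.measure_steps 0 (measurableSet_le_visits _ _ _ _), infinitePi_le_visits]
  · intro m n hmn ω hω
    exact le_trans hω (visits_mono _ _ _ hmn)

lemma IsRandomWalk.one_sub_escapeProb (hX : IsRandomWalk X P) :
    1 - escapeProb X P = (returnProb (P.map (X 1)) 0).toReal := by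
  have hm : MeasurableSet {ω | ∃ n, 1 ≤ n ∧ X n ω = 0} := by
    have : {ω | ∃ n, 1 ≤ n ∧ X n ω = 0} = ⋃ n, ⋃ (_ : 1 ≤ n), X n ⁻¹' {0} := by ext; simp
    rw [this]
    exact .iUnion fun n => .iUnion fun _ => hX.measurable n (.singleton 0)
  have : {ω | ∀ n, 1 ≤ n → X n ω ≠ 0} = {ω | ∃ n, 1 ≤ n ∧ X n ω = 0}ᶜ := by ext; simp
  rw [escapeProb, this, probReal_compl_eq_one_sub hm, hX.returnProb_zero]
  simp [Measure.real]

/-- Union bound over the `n + 1` possible first visit times and the finitely many differences `z`.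
-/
lemma IsRandomWalk.measure_lt_maxPairOcc_le (hX : IsRandomWalk X P) (hs : IsSymmetric X P)
    {K : ℝ} (hK : 0 ≤ K) {q : ENNReal}
    (hq : ∀ z, euclNorm z ≤ K → returnProb (P.map (X 1)) z ≤ q) (n k : ℕ) :
    P {ω | k < maxPairOcc X K n ω} ≤
      (n + 1) * ((finite_euclNorm_le (d := d) K).toFinset.card * q ^ k) := by
  have := hX.isProbabilityMeasure_law
  set B := (finite_euclNorm_le (d := d) K).toFinset
  calc P {ω | k < maxPairOcc X K n ω}
      ≤ P (⋃ s ∈ Finset.range (n + 1), ⋃ z ∈ B,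
          {ω | steps X s ω ∈ {v | k ≤ visits {0, z} 0 v n}}) := by
        refine measure_mono fun ω hω => ?_
        obtain ⟨s, hs, z, hz, h⟩ := exists_le_visits_of_lt_maxPairOcc X hK hω
        simp only [Set.mem_iUnion]
        exact ⟨s, by simpa [Nat.lt_succ_iff] using hs, z, by simpa [B] using hz, h⟩
    _ ≤ ∑ s ∈ Finset.range (n + 1), ∑ z ∈ B, q ^ k := by
        refine (measure_biUnion_finset_le _ _).trans (Finset.sum_le_sum fun s _ => ?_)
        refine (measure_biUnion_finset_le _ _).trans (Finset.sum_le_sum fun z hz => ?_)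
        rw [hX.measure_steps s (measurableSet_le_visits _ _ _ _), infinitePi_le_visits]
        refine (tailProb_le_pow (hX.map_neg_law hs) z n k).trans ?_
        gcongr
        exact (tailProb_le_returnProb z n).trans (hq z (by simpa [B] using hz))
    _ = _ := by simp

/-- Each of `N` independent blocks of length `m * k` must fail to bring `k` returns to the pair
based at the block's starting position. -/
lemma IsRandomWalk.measure_forall_occ_lt_le (hX : IsRandomWalk X P) (hs : IsSymmetric X P)
    (z : Lattice d) {m k N n : ℕ} (hn : N * (m * k) ≤ n) :
    P {ω | ∀ y, occ X n {y, y + z} ω < k} ≤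
      (1 - tailProb (P.map (X 1)) {0, z} m 1 0 ^ k) ^ N := by
  have := hX.isProbabilityMeasure_law
  calc P {ω | ∀ y, occ X n {y, y + z} ω < k}
      ≤ P {ω | steps X 0 ω ∈
          {v | ∀ i < N, visits {0, z} 0 (fun j => v (i * (m * k) + j)) (m * k) < k}} := by
        refine measure_mono fun ω hω i hi => ?_
        by_contra! hc
        have e : (fun j => steps X 0 ω (i * (m * k) + j)) = steps X (i * (m * k)) ω := by
          funext j
          simp [steps]
        rw [e] at hc
        have hle : i * (m * k) + m * k ≤ n := by
          calc i * (m * k) + m * k = (i + 1) * (m * k) := by ring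
            _ ≤ N * (m * k) := by gcongr; omega
            _ ≤ n := hn
        exact absurd (le_occ_pair X hle hc) (not_le.2 (hω _))
    _ = (1 - tailProb (P.map (X 1)) {0, z} (m * k) k 0) ^ N := by
        rw [hX.measure_steps 0 (measurableSet_blocks _ _ _ _), infinitePi_blocks]
    _ ≤ _ := by
        gcongr
        exact pow_le_tailProb (hX.map_neg_law hs) z m k

end Walk

/-! ### Borel–Cantelli arguments at logarithmic scale -/

section Growth

variable {Ω : Type*} [MeasurableSpace Ω] {P : Measure Ω}

/-- A monotone process whose tails at time `n` are at most `C (n + 1) q ^ k` grows at most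
logarithmically, with constant `1 / (-log q)`. -/
lemma ae_eventually_le_mul_log {M : ℕ → Ω → ℕ} (hM : ∀ ω, Monotone fun n => M n ω)
    {C q : ℝ} (hC : 0 ≤ C) (hq0 : 0 < q)
    (htail : ∀ n k : ℕ, P {ω | k < M n ω} ≤ ENNReal.ofReal ((n + 1) * (C * q ^ k)))
    {l : ℝ} (hl0 : 0 < l) (hl : 1 < l * -Real.log q) :
    ∀ᵐ ω ∂P, ∀ᶠ n : ℕ in atTop, (M n ω : ℝ) ≤ l * (Real.log n + Real.log 2) := by
  set c := -Real.log q with hc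
  have hl2 : 0 < Real.log 2 := Real.log_pos (by norm_num)
  have hc0 : 0 < c := by
    by_contra! h
    nlinarith
  -- `r = 2 ^ (1 - l * c)`: at time `2 ^ m` the factor `2 ^ m` from the union bound meets `q ^ (l *
  -- log (2 ^ m))`. Rounding the exponent down costs a factor `exp c`.
  set r := Real.exp (Real.log 2 * (1 - l * c)) with hr
  have hr1 : r < 1 := by
    rw [hr, Real.exp_lt_one_iff]
    nlinarith
  have hqk : ∀ m : ℕ, q ^ ⌊l * (m * Real.log 2)⌋₊ ≤
      Real.exp c * Real.exp (-(l * c * Real.log 2)) ^ m := by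
    intro m
    rw [← Real.exp_nat_mul, ← Real.exp_add, ← Real.exp_log hq0, ← Real.exp_nat_mul,
      Real.exp_le_exp]
    have := (Nat.lt_floor_add_one (l * (m * Real.log 2))).le
    have h2 : Real.log q = -c := by simp [hc]
    rw [h2]
    nlinarith
  have hbound : ∀ m : ℕ, P {ω | ⌊l * (m * Real.log 2)⌋₊ < M (2 ^ m) ω} ≤
      ENNReal.ofReal (2 * C * Real.exp c * r ^ m) := by
    intro m
    refine (htail _ _).trans (ENNReal.ofReal_le_ofReal ?_)
    push_cast
    have h1 : (1 : ℝ) ≤ 2 ^ m := one_le_pow₀ (by norm_num)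
    have h2 : r ^ m = 2 ^ m * Real.exp (-(l * c * Real.log 2)) ^ m := by
      rw [← mul_pow, hr]
      congr 1
      conv_rhs => rw [← Real.exp_log (show (0 : ℝ) < 2 by norm_num), ← Real.exp_add]
      rw [Real.log_exp]
      ring_nf
    calc ((2 : ℝ) ^ m + 1) * (C * q ^ ⌊l * (m * Real.log 2)⌋₊)
        ≤ (2 ^ m + 2 ^ m) * (C * (Real.exp c * Real.exp (-(l * c * Real.log 2)) ^ m)) := by
          gcongr
          exact hqk m
      _ = _ := by rw [h2]; ring
  have hsum : ∑' m : ℕ, P {ω | ⌊l * (m * Real.log 2)⌋₊ < M (2 ^ m) ω} ≠ ⊤ := by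
    have hs : Summable fun m : ℕ => 2 * C * Real.exp c * r ^ m :=
      (summable_geometric_of_lt_one (Real.exp_pos _).le hr1).mul_left _
    exact ne_top_of_le_ne_top hs.tsum_ofReal_ne_top (ENNReal.tsum_le_tsum hbound)
  filter_upwards [ae_eventually_notMem hsum] with ω hω
  -- By monotonicity, `n` is compared with the next power of two, which is at most `2 * n`; this
  -- produces the extra `log 2`.
  have ht : Tendsto (fun n : ℕ => Nat.log 2 n + 1) atTop atTop := by
    refine tendsto_add_atTop_nat 1 |>.comp ?_
    exact tendsto_atTop_atTop.2 fun b => ⟨2 ^ b, fun n hn => Nat.le_log_of_pow_le (by norm_num) hn⟩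
  filter_upwards [ht.eventually hω, eventually_ge_atTop 1] with n hn hn1
  simp only [not_lt] at hn
  have h1 : M n ω ≤ M (2 ^ (Nat.log 2 n + 1)) ω :=
    hM ω (Nat.lt_pow_succ_log_self (by norm_num) n).le
  have h2 : (Nat.log 2 n : ℝ) * Real.log 2 ≤ Real.log n := by
    rw [← Real.log_pow]
    refine Real.log_le_log (by positivity) ?_
    exact_mod_cast Nat.pow_log_le_self 2 (by omega)
  calc (M n ω : ℝ) ≤ (⌊l * ((Nat.log 2 n + 1 : ℕ) * Real.log 2)⌋₊ : ℕ) := by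
        exact_mod_cast h1.trans hn
    _ ≤ l * ((Nat.log 2 n + 1 : ℕ) * Real.log 2) := Nat.floor_le (by positivity)
    _ ≤ _ := by
        push_cast
        gcongr
        linarith

lemma eventually_sq_mul_le_exp {b : ℝ} (hb : 0 < b) (C : ℝ) :
    ∀ᶠ n : ℕ in atTop, C * Real.log n ^ 2 ≤ Real.exp (b * Real.log n) := by
  have h := (isLittleO_pow_exp_pos_mul_atTop 2 hb).bound (c := (|C| + 1)⁻¹) (by positivity)
  filter_upwards [(Real.tendsto_log_atTop.comp tendsto_natCast_atTop_atTop).eventually h] with n hn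
  simp only [Function.comp_apply, norm_pow, Real.norm_eq_abs, sq_abs, Real.abs_exp] at hn
  rw [inv_mul_eq_div, le_div_iff₀ (by positivity)] at hn
  nlinarith [le_abs_self C, sq_nonneg (Real.log n)]

/-- Many independent trials, each with success probability `t ^ k`, with `k` logarithmic in the
number of trials, eventually succeed. -/
lemma ae_eventually_notMem_of_le_pow {E : ℕ → Set Ω} {t l : ℝ} (ht0 : 0 < t) (ht1 : t ≤ 1)
    (hl0 : 0 < l) (hl : l * -Real.log t < 1) {m : ℕ}
    (hE : ∀ n N : ℕ, N * (m * ⌈l * Real.log n⌉₊) ≤ n →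
      P (E n) ≤ ENNReal.ofReal ((1 - t ^ ⌈l * Real.log n⌉₊) ^ N)) :
    ∀ᵐ ω ∂P, ∀ᶠ n : ℕ in atTop, ω ∉ E n := by
  set c := -Real.log t with hc
  have hc0 : 0 ≤ c := by
    have := Real.log_nonpos ht0.le ht1
    linarith
  have key : ∀ᶠ n : ℕ in atTop, P (E n) ≤ ENNReal.ofReal (1 / (n : ℝ) ^ 2) := by
    have hlog : Tendsto (fun n : ℕ => Real.log n) atTop atTop :=
      Real.tendsto_log_atTop.comp tendsto_natCast_atTop_atTop
    -- For `u = log n ≥ 1`, the constant collects `2 * u + 1 ≤ 3 * u`, `l * u + 1 ≤ (l + 1) * u` and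
    -- the factor `exp c` lost by rounding `k` up.
    filter_upwards [eventually_sq_mul_le_exp (b := 1 - l * c) (by linarith)
      (3 * (m + 1) * (l + 1) * Real.exp c), hlog.eventually_ge_atTop 1, eventually_ge_atTop 1]
      with n hexp hu hn1
    set u := Real.log n with hudef
    set k := ⌈l * u⌉₊ with hk
    have hn0 : (0 : ℝ) < n := by exact_mod_cast hn1
    have hku : (k : ℝ) ≤ l * u + 1 := (Nat.ceil_lt_add_one (by positivity)).le
    -- Using `m + 1` keeps the divisor positive when `m = 0`.
    set N := n / ((m + 1) * k) with hN
    have hNr : N * (m * k) ≤ n := by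
      refine le_trans ?_ (Nat.div_mul_le_self n ((m + 1) * k))
      gcongr
      omega
    have hk0 : 0 < k := Nat.ceil_pos.2 (by positivity)
    have hNlow : (n : ℝ) ≤ (N + 1) * ((m + 1) * (l * u + 1)) := by
      have h := (Nat.lt_div_mul_add (a := n) (b := (m + 1) * k) (by positivity)).le
      rw [← hN] at h
      have h' : (n : ℝ) ≤ N * ((m + 1) * k) + (m + 1) * k := by exact_mod_cast h
      calc (n : ℝ) ≤ (N + 1) * ((m + 1) * k) := by linarith
        _ ≤ _ := by gcongr
    have htk : Real.exp (-c) * Real.exp (-(l * c) * u) ≤ t ^ k := by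
      rw [← Real.exp_add, ← Real.exp_log ht0, ← Real.exp_nat_mul, Real.exp_le_exp]
      have h2 : Real.log t = -c := by simp [hc]
      rw [h2]
      nlinarith
    have htk1 : t ^ k ≤ 1 := pow_le_one₀ ht0.le ht1
    -- About `n / log n` trials, each succeeding with probability of order `n ^ (-l * c)`, give more
    -- than `2 * log n` expected successes, hence failure probability at most `n ^ (-2)`.
    have hmain : 2 * u ≤ N * t ^ k := by
      have hq : (2 * u + 1) * ((m + 1) * (l * u + 1)) ≤ n * t ^ k := by
        calc (2 * u + 1) * ((m + 1) * (l * u + 1))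
            ≤ (3 * u) * ((m + 1) * ((l + 1) * u)) := by gcongr <;> nlinarith
          _ = Real.exp (-c) * (3 * (m + 1) * (l + 1) * Real.exp c * u ^ 2) := by
            have : Real.exp (-c) * Real.exp c = 1 := by rw [← Real.exp_add]; simp
            linear_combination (-(3 * (m + 1) * (l + 1) * u ^ 2)) * this
          _ ≤ Real.exp (-c) * Real.exp ((1 - l * c) * u) := by gcongr
          _ = n * (Real.exp (-c) * Real.exp (-(l * c) * u)) := by
            conv_rhs => rw [← Real.exp_log hn0, ← hudef]
            rw [← Real.exp_add, ← Real.exp_add, ← Real.exp_add]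
            ring_nf
          _ ≤ _ := by gcongr
      have hpos : 0 < (m + 1) * (l * u + 1) := by positivity
      have h3 : n * t ^ k ≤ ((N + 1) * t ^ k) * ((m + 1) * (l * u + 1)) := by
        calc n * t ^ k ≤ ((N + 1) * ((m + 1) * (l * u + 1))) * t ^ k := by gcongr
          _ = _ := by ring
      have h4 := le_of_mul_le_mul_right (hq.trans h3) hpos
      linarith
    refine (hE n N hNr).trans (ENNReal.ofReal_le_ofReal ?_)
    calc (1 - t ^ k) ^ N ≤ Real.exp (-(t ^ k)) ^ N := by
          gcongr
          exact Real.one_sub_le_exp_neg _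
      _ = Real.exp (-(N * t ^ k)) := by rw [← Real.exp_nat_mul]; ring_nf
      _ ≤ Real.exp (-(2 * u)) := by gcongr
      _ = 1 / (n : ℝ) ^ 2 := by
        rw [Real.exp_neg, one_div, show 2 * u = u + u by ring, Real.exp_add, hudef,
          Real.exp_log hn0, sq]
  obtain ⟨n₀, hn₀⟩ := eventually_atTop.1 key
  have hsum : ∑' n : ℕ, P (E (n + n₀)) ≠ ⊤ := by
    have hs : Summable fun n : ℕ => 1 / ((n + n₀ : ℕ) : ℝ) ^ 2 :=
      (summable_nat_add_iff n₀ (f := fun n : ℕ => 1 / (n : ℝ) ^ 2)).2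
        (Real.summable_one_div_nat_pow.2 (by norm_num))
    exact ne_top_of_le_ne_top hs.tsum_ofReal_ne_top
      (ENNReal.tsum_le_tsum fun n => hn₀ _ (Nat.le_add_left _ _))
  filter_upwards [ae_eventually_notMem hsum] with ω hω
  filter_upwards [(tendsto_sub_atTop_nat n₀).eventually hω, eventually_ge_atTop n₀] with n hn hn1
  rwa [Nat.sub_add_cancel hn1] at hn

end Growth

/-! ### The growth constant and the separation of nearly maximal points -/

lemma tendsto_div_log_of_forall {f : ℕ → ℝ} {L : ℝ} (hL : 0 < L)
    (hup : ∀ j : ℕ, ∀ᶠ n : ℕ in atTop,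
      f n ≤ L * (1 + 1 / ((j : ℝ) + 1)) * (Real.log n + Real.log 2))
    (hlow : ∀ j : ℕ, ∀ᶠ n : ℕ in atTop, L * (1 - 1 / ((j : ℝ) + 2)) * Real.log n ≤ f n) :
    Tendsto (fun n : ℕ => f n / Real.log n) atTop (𝓝 L) := by
  have hlog : Tendsto (fun n : ℕ => Real.log n) atTop atTop :=
    Real.tendsto_log_atTop.comp tendsto_natCast_atTop_atTop
  have hj : Tendsto (fun j : ℕ => 1 / ((j : ℝ) + 1)) atTop (𝓝 0) :=
    tendsto_one_div_add_atTop_nhds_zero_nat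
  refine tendsto_order.2 ⟨fun a ha => ?_, fun a ha => ?_⟩
  · have hj' : Tendsto (fun j : ℕ => L * (1 - 1 / ((j : ℝ) + 2))) atTop (𝓝 L) := by
      have h := (hj.comp (tendsto_add_atTop_nat 1)).const_sub 1 |>.const_mul L
      rw [sub_zero, mul_one] at h
      refine h.congr fun j => ?_
      simp only [Function.comp_apply]
      push_cast
      ring
    obtain ⟨j, hj⟩ := (hj'.eventually_const_lt ha).exists
    filter_upwards [hlow j, hlog.eventually_gt_atTop 0] with n hn h0
    rw [lt_div_iff₀ h0]
    exact lt_of_lt_of_le (by gcongr) hn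
  · have hj' : Tendsto (fun j : ℕ => L * (1 + 1 / ((j : ℝ) + 1))) atTop (𝓝 L) := by
      simpa using (hj.const_add 1).const_mul L
    obtain ⟨j, hj⟩ := (hj'.eventually_lt_const ha).exists
    have ht : Tendsto (fun n : ℕ => L * (1 + 1 / ((j : ℝ) + 1)) * (1 + Real.log 2 / Real.log n))
        atTop (𝓝 (L * (1 + 1 / ((j : ℝ) + 1)))) := by
      simpa using ((hlog.const_div_atTop (Real.log 2)).const_add 1).const_mul
        (L * (1 + 1 / ((j : ℝ) + 1)))
    filter_upwards [hup j, hlog.eventually_gt_atTop 0, ht.eventually_lt_const hj] with n hn h0 h1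
    rw [div_lt_iff₀ h0]
    refine hn.trans_lt ?_
    calc L * (1 + 1 / ((j : ℝ) + 1)) * (Real.log n + Real.log 2)
        = L * (1 + 1 / ((j : ℝ) + 1)) * (1 + Real.log 2 / Real.log n) * Real.log n := by
          field_simp
      _ < a * Real.log n := by gcongr

variable {d : ℕ} {Ω : Type*} [MeasurableSpace Ω] {P : Measure Ω} [IsProbabilityMeasure P]
  {X : ℕ → Ω → Lattice d}

lemma IsRandomWalk.ae_eventually_exists_le_occ (hX : IsRandomWalk X P) (hs : IsSymmetric X P)
    (z : Lattice d) (hq0 : 0 < (returnProb (P.map (X 1)) z).toReal) {l : ℝ} (hl0 : 0 < l)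
    (hl : l * -Real.log (returnProb (P.map (X 1)) z).toReal < 1) :
    ∀ᵐ ω ∂P, ∀ᶠ n : ℕ in atTop, ∃ y, l * Real.log n ≤ occ X n {y, y + z} ω := by
  have := hX.isProbabilityMeasure_law
  set ν := P.map (X 1)
  have hqt : returnProb ν z ≠ ⊤ := ne_top_of_le_ne_top ENNReal.one_ne_top (returnProb_le_one z)
  -- The condition on `l` is strict, so a finite horizon `m` already has return probability above
  -- `exp (-1 / l)`.
  have h1 : Real.exp (-(1 / l)) < (returnProb ν z).toReal := by
    rw [← Real.lt_log_iff_exp_lt hq0, neg_lt, lt_div_iff₀ hl0]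
    linarith
  obtain ⟨m, hm⟩ := lt_iSup_iff.1 ((ENNReal.ofReal_lt_iff_lt_toReal (Real.exp_pos _).le hqt).2 h1)
  set t := tailProb ν {0, z} m 1 0
  have ht1 : t ≤ 1 := tailProb_le_one m 1 0
  have htt : t ≠ ⊤ := ne_top_of_le_ne_top ENNReal.one_ne_top ht1
  rw [ENNReal.ofReal_lt_iff_lt_toReal (Real.exp_pos _).le htt] at hm
  have ht0 : 0 < t.toReal := (Real.exp_pos _).trans hm
  have ht1' : t.toReal ≤ 1 := by simpa using ENNReal.toReal_mono ENNReal.one_ne_top ht1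
  have hlt : l * -Real.log t.toReal < 1 := by
    rw [← Real.lt_log_iff_exp_lt ht0, neg_lt, lt_div_iff₀ hl0] at hm
    linarith
  have hE : ∀ᵐ ω ∂P, ∀ᶠ n : ℕ in atTop,
      ω ∉ {ω | ∀ y, occ X n {y, y + z} ω < ⌈l * Real.log n⌉₊} := by
    refine ae_eventually_notMem_of_le_pow (m := m) ht0 ht1' hl0 hlt fun n N hN => ?_
    refine (hX.measure_forall_occ_lt_le hs z hN).trans_eq ?_
    rw [ENNReal.ofReal_pow (sub_nonneg.2 (pow_le_one₀ ht0.le ht1')),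
      ENNReal.ofReal_sub _ (by positivity), ENNReal.ofReal_pow ht0.le, ENNReal.ofReal_toReal htt,
      ENNReal.ofReal_one]
  filter_upwards [hE] with ω hω
  filter_upwards [hω] with n hn
  simp only [not_forall, not_lt] at hn
  obtain ⟨y, hy⟩ := hn
  exact ⟨y, (Nat.le_ceil _).trans (by exact_mod_cast hy)⟩

lemma IsRandomWalk.ae_eventually_maxPairOcc_le (hX : IsRandomWalk X P) (hs : IsSymmetric X P)
    {K : ℝ} (hK : 0 ≤ K) {q : ENNReal} (hqt : q ≠ ⊤) (hq0 : 0 < q.toReal)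
    (hq : ∀ z, euclNorm z ≤ K → returnProb (P.map (X 1)) z ≤ q) {l : ℝ} (hl0 : 0 < l)
    (hl : 1 < l * -Real.log q.toReal) :
    ∀ᵐ ω ∂P, ∀ᶠ n : ℕ in atTop,
      (maxPairOcc X K n ω : ℝ) ≤ l * (Real.log n + Real.log 2) := by
  refine ae_eventually_le_mul_log (maxPairOcc_mono_time X hK)
    (Nat.cast_nonneg (finite_euclNorm_le (d := d) K).toFinset.card) hq0 (fun n k => ?_) hl0 hl
  refine (hX.measure_lt_maxPairOcc_le hs hK hq n k).trans_eq ?_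
  rw [ENNReal.ofReal_mul (by positivity), ENNReal.ofReal_mul (by positivity),
    ENNReal.ofReal_pow hq0.le, ENNReal.ofReal_toReal hqt, ENNReal.ofReal_natCast,
    ENNReal.ofReal_add (by positivity) zero_le_one, ENNReal.ofReal_natCast, ENNReal.ofReal_one]

/-- The growth constant of the occupation of pairs at distance at most `K`. -/
lemma IsRandomWalk.ae_tendsto_maxPairOcc (hX : IsRandomWalk X P) (hs : IsSymmetric X P)
    {K : ℝ} (hK : 0 ≤ K) {z : Lattice d} (hz : euclNorm z ≤ K)
    (hmax : ∀ w, euclNorm w ≤ K → returnProb (P.map (X 1)) w ≤ returnProb (P.map (X 1)) z)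
    (hq0 : 0 < (returnProb (P.map (X 1)) z).toReal)
    (hq1 : (returnProb (P.map (X 1)) z).toReal < 1) :
    ∀ᵐ ω ∂P, Tendsto (fun n : ℕ => (maxPairOcc X K n ω : ℝ) / Real.log n) atTop
      (𝓝 (1 / -Real.log (returnProb (P.map (X 1)) z).toReal)) := by
  have := hX.isProbabilityMeasure_law
  have hqt : returnProb (P.map (X 1)) z ≠ ⊤ :=
    ne_top_of_le_ne_top ENNReal.one_ne_top (returnProb_le_one z)
  set c := -Real.log (returnProb (P.map (X 1)) z).toReal with hc
  have hc0 : 0 < c := neg_pos.2 (Real.log_neg hq0 hq1)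
  have hup : ∀ j : ℕ, ∀ᵐ ω ∂P, ∀ᶠ n : ℕ in atTop, (maxPairOcc X K n ω : ℝ) ≤
      1 / c * (1 + 1 / ((j : ℝ) + 1)) * (Real.log n + Real.log 2) := fun j => by
    refine hX.ae_eventually_maxPairOcc_le hs hK hqt hq0 hmax (by positivity) ?_
    rw [← hc, mul_right_comm, one_div_mul_cancel hc0.ne', one_mul, lt_add_iff_pos_right]
    positivity
  -- The shift by `2` keeps the factor positive at `j = 0`.
  have hlow : ∀ j : ℕ, ∀ᵐ ω ∂P, ∀ᶠ n : ℕ in atTop, ∃ y,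
      1 / c * (1 - 1 / ((j : ℝ) + 2)) * Real.log n ≤ occ X n {y, y + z} ω := fun j => by
    refine hX.ae_eventually_exists_le_occ hs z hq0 ?_ ?_
    · refine mul_pos (by positivity) (sub_pos.2 ?_)
      rw [div_lt_one (by positivity)]
      linarith [Nat.cast_nonneg (α := ℝ) j]
    · rw [← hc, mul_right_comm, one_div_mul_cancel hc0.ne', one_mul, sub_lt_self_iff]
      positivity
  filter_upwards [ae_all_iff.2 hup, ae_all_iff.2 hlow] with ω h1 h2
  refine tendsto_div_log_of_forall (by positivity) h1 fun j => ?_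
  filter_upwards [h2 j] with n ⟨y, hy⟩
  refine hy.trans ?_
  exact_mod_cast occ_le_maxPairOcc X hK (by rwa [sub_add_cancel_left, euclNorm_neg]) n ω

lemma Lattice.ne_neg_of_ne_zero {z : Lattice d} (hz : z ≠ 0) : z ≠ -z := by
  intro h
  refine hz (funext fun i => ?_)
  have := congrFun h i
  simp only [Pi.neg_apply, Pi.zero_apply] at this ⊢
  omega

/-- Otherwise the pair is counted in `maxPairOcc`, while its two points together receive at least `2
* (1 - ε) * l` visits. -/
lemma lt_euclNorm_of_nearly_maximal {K ε l L : ℝ} (hK : 0 ≤ K) (hε : ε ≤ 1) {n : ℕ} {ω : Ω}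
    (hpair : (maxPairOcc X K n ω : ℝ) < L) {y₀ : Lattice d} (hl : l ≤ occ X n {y₀} ω)
    (hLl : L ≤ 2 * ((1 - ε) * l)) {x y : Lattice d} (hxy : x ≠ y)
    (hx : ∀ z, (1 - ε) * (occ X n {z} ω : ℝ) ≤ occ X n {x} ω)
    (hy : ∀ z, (1 - ε) * (occ X n {z} ω : ℝ) ≤ occ X n {y} ω) : K < euclNorm (x - y) := by
  by_contra! hc
  have h1 : (occ X n {x, y} ω : ℝ) ≤ maxPairOcc X K n ω := by
    exact_mod_cast occ_le_maxPairOcc X hK hc n ω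
  rw [occ_pair_of_ne X hxy] at h1
  push_cast at h1
  have h2 : (1 - ε) * l ≤ (1 - ε) * occ X n {y₀} ω :=
    mul_le_mul_of_nonneg_left hl (by linarith)
  linarith [hx y₀, hy y₀]

end FreqVisited

theorem corollary1p3 {d : ℕ} (hd : 3 ≤ d) {Ω : Type*} [MeasurableSpace Ω] (P : Measure Ω)
    [IsProbabilityMeasure P] (X : ℕ → Ω → FreqVisited.Lattice d)
    (hX : FreqVisited.IsRandomWalk X P) (hsymm : FreqVisited.IsSymmetric X P)
    (htrans : FreqVisited.IsTransient X P) (hfull : FreqVisited.IsFullySupported X P)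
    (hmom : FreqVisited.HasFiniteSecondMoments X P) :
    (∀ K : ℝ, 0 < K →
      -- the limit exists almost surely and is smaller than twice the one-point constant
      (∃ L : ℝ, L < -2 / Real.log (1 - FreqVisited.escapeProb X P) ∧
        ∀ᵐ ω ∂P, Tendsto (fun n : ℕ => (FreqVisited.maxPairOcc X K n ω : ℝ) / Real.log n)
          atTop (𝓝 L)) ∧
      -- two distinct points that are both visited nearly maximally often are further apart than K
      (∃ ε : ℝ, 0 < ε ∧ ∀ᵐ ω ∂P, ∀ᶠ n : ℕ in atTop, ∀ x y : FreqVisited.Lattice d, x ≠ y →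
        (∀ z, (1 - ε) * (FreqVisited.occ X n {z} ω : ℝ) ≤ FreqVisited.occ X n {x} ω) →
        (∀ z, (1 - ε) * (FreqVisited.occ X n {z} ω : ℝ) ≤ FreqVisited.occ X n {y} ω) →
        K < FreqVisited.euclNorm (x - y))) ∧
    -- a neighbour of a maximally visited point is not maximally visited
    (∀ᵐ ω ∂P, ∀ᶠ n : ℕ in atTop, ∀ x y : FreqVisited.Lattice d,
      FreqVisited.euclNorm (x - y) = 1 →
      (∀ z, FreqVisited.occ X n {z} ω ≤ FreqVisited.occ X n {x} ω) →
      ¬ ∀ z, FreqVisited.occ X n {z} ω ≤ FreqVisited.occ X n {y} ω) := by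

  have := hX.isProbabilityMeasure_law
  have hν := hX.map_neg_law hsymm
  set ν := P.map (X 1) with hνdef
  set p := (FreqVisited.returnProb ν 0).toReal with hp
  have hγ : 1 - FreqVisited.escapeProb X P = p := hX.one_sub_escapeProb
  have htr : FreqVisited.returnProb ν 0 < 1 := by
    rw [hX.returnProb_zero]
    exact htrans
  have hne : (fun _ => 1 : FreqVisited.Lattice d) ≠ 0 := fun h => by
    simpa using congrFun h ⟨0, by omega⟩
  have hp0 : 0 < p :=
    (FreqVisited.returnProb_sq_lt hν (FreqVisited.Lattice.ne_neg_of_ne_zero hne) htr).1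
  have hp1 : p < 1 := by
    simpa using (ENNReal.toReal_lt_toReal htr.ne_top ENNReal.one_ne_top).2 htr
  have hlogp : Real.log p < 0 := Real.log_neg hp0 hp1
  have hpairs : ∀ z : FreqVisited.Lattice d, (FreqVisited.returnProb ν z).toReal < 1 ∧
      (FreqVisited.returnProb ν z).toReal ^ 2 < p := fun z => by
    by_cases hz : z = 0
    · rw [hz, ← hp]
      exact ⟨hp1, by nlinarith⟩
    · exact (FreqVisited.returnProb_sq_lt hν (FreqVisited.Lattice.ne_neg_of_ne_zero hz) htr).2
  rw [hγ]
  have hmain : ∀ K : ℝ, 0 < K →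
      (∃ L : ℝ, L < -2 / Real.log p ∧
        ∀ᵐ ω ∂P, Tendsto (fun n : ℕ => (FreqVisited.maxPairOcc X K n ω : ℝ) / Real.log n)
          atTop (𝓝 L)) ∧
      (∃ ε : ℝ, 0 < ε ∧ ∀ᵐ ω ∂P, ∀ᶠ n : ℕ in atTop, ∀ x y : FreqVisited.Lattice d, x ≠ y →
        (∀ z, (1 - ε) * (FreqVisited.occ X n {z} ω : ℝ) ≤ FreqVisited.occ X n {x} ω) →
        (∀ z, (1 - ε) * (FreqVisited.occ X n {z} ω : ℝ) ≤ FreqVisited.occ X n {y} ω) →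
        K < FreqVisited.euclNorm (x - y)) := by
    intro K hK
    have h0mem : (0 : FreqVisited.Lattice d) ∈ {z | FreqVisited.euclNorm z ≤ K} :=
      FreqVisited.euclNorm_zero.trans_le hK.le
    obtain ⟨z, hz, hmax⟩ := Set.exists_max_image {z | FreqVisited.euclNorm z ≤ K}
      (fun z : FreqVisited.Lattice d => FreqVisited.returnProb ν z)
      (FreqVisited.finite_euclNorm_le K) ⟨0, h0mem⟩
    obtain ⟨hq1, hq2⟩ := hpairs z
    have hq0 : 0 < (FreqVisited.returnProb ν z).toReal :=
      hp0.trans_le (ENNReal.toReal_mono (ne_top_of_le_ne_top ENNReal.one_ne_top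
        (FreqVisited.returnProb_le_one z)) (hmax 0 h0mem))
    have hlim := hX.ae_tendsto_maxPairOcc hsymm hK.le hz hmax hq0 hq1
    set c := -Real.log (FreqVisited.returnProb ν z).toReal with hc
    have hc0 : 0 < c := neg_pos.2 (Real.log_neg hq0 hq1)
    -- This is `q ^ 2 < p` in logarithmic form; it gives the strict bound on the growth constant.
    have hcp : -Real.log p < 2 * c := by
      have h := Real.log_lt_log (by positivity) hq2
      rw [Real.log_pow] at h
      push_cast at h
      linarith
    have hL : 1 / c < -2 / Real.log p := by
      rw [← neg_div_neg_eq (-2), neg_neg, div_lt_div_iff₀ hc0 (by linarith)]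
      linarith
    refine ⟨⟨1 / c, hL, hlim⟩, ?_⟩
    set L := 1 / c with hLdef
    have hL0 : 0 < L := by positivity
    -- Some point receives at least `l * log n` visits as soon as `l` is below the one-point
    -- constant; `L < 2 * l` leaves room for `ε`.
    obtain ⟨l, hl1, hl2⟩ : ∃ l, L / 2 < l ∧ l < -1 / Real.log p := by
      refine exists_between ?_
      have : -2 / Real.log p = 2 * (-1 / Real.log p) := by ring
      linarith
    have hl0 : 0 < l := by linarith
    have hlp : l * -Real.log p < 1 := by
      rw [← neg_div_neg_eq (-1), neg_neg, lt_div_iff₀ (by linarith)] at hl2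
      exact hl2
    -- This `ε` makes `2 * (1 - ε) * l` the midpoint of `L` and `2 * l`.
    refine ⟨(2 * l - L) / (4 * l), div_pos (by linarith) (by linarith), ?_⟩
    have hε : (2 * l - L) / (4 * l) ≤ 1 := by
      rw [div_le_one (by linarith)]
      linarith
    have hLl : 2 * ((1 - (2 * l - L) / (4 * l)) * l) = (L + 2 * l) / 2 := by
      field_simp
      ring
    -- The degenerate pair `z = 0` supplies the one-point lower bound.
    filter_upwards [hlim, hX.ae_eventually_exists_le_occ hsymm 0 hp0 hl0 hlp] with ω h1 h2
    have hlog : Tendsto (fun n : ℕ => Real.log n) atTop atTop :=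
      Real.tendsto_log_atTop.comp tendsto_natCast_atTop_atTop
    filter_upwards [h1.eventually_lt_const (show L < (L + 2 * l) / 2 by linarith), h2,
      hlog.eventually_gt_atTop 0] with n hn1 hn2 hn3 x y hxy hx hy
    obtain ⟨y₀, hy₀⟩ := hn2
    rw [add_zero, Set.pair_eq_singleton] at hy₀
    rw [div_lt_iff₀ hn3] at hn1
    refine FreqVisited.lt_euclNorm_of_nearly_maximal hK.le hε hn1 hy₀ ?_ hxy hx hy
    rw [← hLl]
    exact le_of_eq (by ring)
  refine ⟨hmain, ?_⟩
  -- With `K = 1`, maximal points are nearly maximal, so two distinct ones are at distance strictly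
  -- above `1`.
  obtain ⟨ε, hε, h⟩ := (hmain 1 one_pos).2
  filter_upwards [h] with ω hω
  filter_upwards [hω] with n hn x y hxy hx hy
  have hle : ∀ {a b : ℕ}, a ≤ b → (1 - ε) * (a : ℝ) ≤ b := fun {a b} hab => by
    have : (a : ℝ) ≤ b := by exact_mod_cast hab
    nlinarith [mul_nonneg hε.le (Nat.cast_nonneg (α := ℝ) a)]
  have hne : x ≠ y := by
    rintro rfl
    rw [sub_self, FreqVisited.euclNorm_zero] at hxy
    exact zero_ne_one hxy
  exact absurd hxy (hn x y hne (fun z => hle (hx z)) fun z => hle (hy z)).ne'
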